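/- **Corollary (MNW for homogeneous divisible items).** Consider $n\ge 1$ agents and $m$ homogeneous divisible items, one unit of each. Agent $i$ has values $v_i=(v_{i1},\dots,v_{im})$ with $v_{it}\ge 0$ and $\sum_t v_{it}>0$. An allocation with free disposal is a matrix $A=(a_{it})$ with $a_{it}\ge 0$ and $\sum_i a_{it}\le 1$ for every item $t$; without free disposal, $\sum_i a_{it}=1$ is required for every $t$. The value of agent $i$ in $A$ is $v_i(A_i)=\sum_t v_{it}a_{it}$, and the Nash welfare of $A$ is $\bigl(\prod_i v_i(A_i)\bigr)^{1/n}$. A maximum Nash welfare (MNW) mechanism, with or without free disposal, is a deterministic mechanism $M$ that, for all $n\ge 1$, $m$ and every profile of reported values (each report being non-negative with positive sum), returns an allocation with maximum Nash welfare with respect to the reports among all allocations with, respectively without, free disposal, ties being broken arbitrarily. The incentive ratio of $M$ is $$\sup_{n,m}\ \sup_{v_1,\dots,v_n}\ \sup_{i}\ \sup_{v_i'}\ \frac{v_i\bigl(M_i(v_1,\dots,v_i',\dots,v_n)\bigr)}{v_i\bigl(M_i(v_1,\dots,v_i,\dots,v_n)\bigr)}\in[0,\infty],$$ where $v_i'$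 ranges over the possible reports of agent $i$. Then every MNW mechanism without free disposal has incentive ratio exactly $2$. Moreover, every MNW mechanism with free disposal has incentive ratio at least $2$. -/

import Mathlib

open scoped ENNReal BigOperators

noncomputable section

namespace DivisibleItems

/-- The (true or reported) values of one agent for `m` homogeneous divisible items: every item has
a non-negative value and the value of all items together is strictly positive. -/
def ItemValues (m : ℕ) : Type :=
  {w : Fin m → ℝ // (∀ t, 0 ≤ w t) ∧ 0 < ∑ t, w t}

/-- An allocation of one unit of each of `m` items to `n` agents, where `share i t` is the fraction
of item `t` that agent `i` receives. A part of an item may stay unallocated (free disposal). -/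
structure Allocation (n m : ℕ) where
  share : Fin n → Fin m → ℝ
  share_nonneg : ∀ i t, 0 ≤ share i t
  sum_share_le_one : ∀ t, ∑ i, share i t ≤ 1

/-- All items are allocated completely (no free disposal). -/
def Allocation.IsComplete {n m : ℕ} (A : Allocation n m) : Prop :=
  ∀ t, ∑ i, A.share i t = 1

/-- The value, for an agent with item values `w`, of what agent `i` receives in `A`. -/
def bundleValue {n m : ℕ} (w : ItemValues m) (A : Allocation n m) (i : Fin n) : ℝ :=
  ∑ t, w.1 t * A.share i t

/-- Nash welfare: the geometric mean of the agents' values for their own bundles. -/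
def nashWelfare {n m : ℕ} (v : Fin n → ItemValues m) (A : Allocation n m) : ℝ :=
  (∏ i, bundleValue (v i) A i) ^ ((1 : ℝ) / (n : ℝ))

/-- A maximum Nash welfare allocation when items may be discarded. -/
def IsMNWFreeDisposal {n m : ℕ} (v : Fin n → ItemValues m) (A : Allocation n m) : Prop :=
  ∀ B : Allocation n m, nashWelfare v B ≤ nashWelfare v A

/-- A maximum Nash welfare allocation when items have to be allocated completely. -/
def IsMNWComplete {n m : ℕ} (v : Fin n → ItemValues m) (A : Allocation n m) : Prop :=
  A.IsComplete ∧ ∀ B : Allocation n m, B.IsComplete → nashWelfare v B ≤ nashWelfare v A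

/-- A deterministic mechanism: for all numbers `n` of agents and `m` of items, it maps every
profile of reported item values to an allocation. -/
abbrev Mechanism : Type :=
  (n m : ℕ) → (Fin n → ItemValues m) → Allocation n m

/-- `M` is the MNW mechanism with free disposal, for some way of breaking ties. -/
def Mechanism.IsMNWWithFreeDisposal (M : Mechanism) : Prop :=
  ∀ n m : ℕ, 0 < n → ∀ v : Fin n → ItemValues m, IsMNWFreeDisposal v (M n m v)

/-- `M` is the MNW mechanism without free disposal, for some way of breaking ties. -/
def Mechanism.IsMNWWithoutFreeDisposal (M : Mechanism) : Prop :=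
  ∀ n m : ℕ, 0 < n → ∀ v : Fin n → ItemValues m, IsMNWComplete v (M n m v)

/-- The incentive ratio: the supremum, over all instances with true values `v`, all agents `i` and
all misreports `w` of agent `i`, of the true value that agent `i` obtains by misreporting divided
by the value that agent `i` obtains by reporting truthfully. The quotient is taken in `[0, ∞]`,
so that an infinite or unbounded gain gives the ratio `∞`. -/
def Mechanism.incentiveRatio (M : Mechanism) : ℝ≥0∞ :=
  ⨆ (n : ℕ) (m : ℕ) (v : Fin n → ItemValues m) (i : Fin n) (w : ItemValues m),
    ENNReal.ofReal (bundleValue (v i) (M n m (Function.update v i w)) i) /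
      ENNReal.ofReal (bundleValue (v i) (M n m v) i)

end DivisibleItems

end

open scoped ENNReal BigOperators
open Filter Topology

noncomputable section

namespace DivisibleItems

variable {n m : ℕ}

/-! ### Convex combinations of allocations -/

/-! Maximum Nash welfare over a convex set gives proportional fairness: if `A` is optimal, the
ratios of values in `B` to values in `A` sum to at most `n` (`IsMNWOn.sum_div_le`). For the upper
bound, apply this to the truthful optimum and to the misreported one, each against the other, and
add. Every other agent contributes some `r + 1/r ≥ 2`, so of the total `2 * n` at most `2` remains
for the manipulator's gain. For the lower bound, a market equilibrium pins down the values in every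
optimum (`IsMNWOn.bundleValue_eq`), so tie-breaking is irrelevant. In `exists_misreport` an agent
who owns a private item understates it and gains the factor `2 * k / (k + 1)`, which tends to `2`.
-/

/-- The convex combination `(1 - s) A + s B` of two allocations. -/
def Allocation.mix (A B : Allocation n m) (s : ℝ) (hs : 0 ≤ s) (hs1 : s ≤ 1) :
    Allocation n m where
  share i t := (1 - s) * A.share i t + s * B.share i t
  share_nonneg i t := add_nonneg (mul_nonneg (sub_nonneg.2 hs1) (A.share_nonneg i t))
    (mul_nonneg hs (B.share_nonneg i t))
  sum_share_le_one t := by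
    rw [Finset.sum_add_distrib, ← Finset.mul_sum, ← Finset.mul_sum]
    nlinarith [A.sum_share_le_one t, B.sum_share_le_one t]

/-- The allocation that splits every item equally. -/
def Allocation.equal (n m : ℕ) : Allocation n m where
  share _ _ := (n : ℝ)⁻¹
  share_nonneg _ _ := by positivity
  sum_share_le_one t := by
    simpa using mul_inv_le_one

lemma Allocation.equal_isComplete (hn : 0 < n) : (Allocation.equal n m).IsComplete := by
  intro t
  have : (n : ℝ) ≠ 0 := by positivity
  simp [Allocation.equal, this]

lemma Allocation.IsComplete.mix {A B : Allocation n m} (hA : A.IsComplete) (hB : B.IsComplete)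
    {s : ℝ} (hs : 0 ≤ s) (hs1 : s ≤ 1) : (A.mix B s hs hs1).IsComplete := by
  intro t
  change ∑ i, ((1 - s) * A.share i t + s * B.share i t) = 1
  rw [Finset.sum_add_distrib, ← Finset.mul_sum, ← Finset.mul_sum, hA t, hB t]
  ring

lemma bundleValue_nonneg (w : ItemValues m) (A : Allocation n m) (i : Fin n) :
    0 ≤ bundleValue w A i :=
  Finset.sum_nonneg fun t _ => mul_nonneg (w.2.1 t) (A.share_nonneg i t)

lemma bundleValue_mix (w : ItemValues m) (A B : Allocation n m) {s : ℝ} (hs : 0 ≤ s)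
    (hs1 : s ≤ 1) (i : Fin n) :
    bundleValue w (A.mix B s hs hs1) i =
      bundleValue w A i + s * (bundleValue w B i - bundleValue w A i) := by
  simp only [bundleValue, Allocation.mix, ← Finset.sum_sub_distrib, Finset.mul_sum,
    ← Finset.sum_add_distrib]
  exact Finset.sum_congr rfl fun t _ => by ring

lemma bundleValue_equal_pos (hn : 0 < n) (w : ItemValues m) (i : Fin n) :
    0 < bundleValue w (Allocation.equal n m) i := by
  have hw := w.2.2
  simp only [bundleValue, Allocation.equal, ← Finset.sum_mul]
  positivity

lemma prod_le_prod_of_nashWelfare_le (hn : 0 < n) {v : Fin n → ItemValues m}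
    {A B : Allocation n m} (h : nashWelfare v B ≤ nashWelfare v A) :
    ∏ i, bundleValue (v i) B i ≤ ∏ i, bundleValue (v i) A i :=
  (Real.rpow_le_rpow_iff (Finset.prod_nonneg fun i _ => bundleValue_nonneg _ _ i)
    (Finset.prod_nonneg fun i _ => bundleValue_nonneg _ _ i) (by positivity)).1 h

/-! ### Maximum Nash welfare over a convex set of allocations -/

/-- The set of allocations contains the equal split and is convex. -/
structure IsAdmissible (S : Set (Allocation n m)) : Prop where
  equal_mem : Allocation.equal n m ∈ S
  mix_mem : ∀ A ∈ S, ∀ B ∈ S, ∀ (s : ℝ) (hs : 0 ≤ s) (hs1 : s ≤ 1), A.mix B s hs hs1 ∈ S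

lemma isAdmissible_univ : IsAdmissible (Set.univ : Set (Allocation n m)) :=
  ⟨trivial, fun _ _ _ _ _ _ _ => trivial⟩

lemma isAdmissible_complete (hn : 0 < n) :
    IsAdmissible {A : Allocation n m | A.IsComplete} :=
  ⟨Allocation.equal_isComplete hn, fun _ hA _ hB _ hs hs1 => Allocation.IsComplete.mix hA hB hs hs1⟩

/-- `A` maximizes Nash welfare over `S`. -/
def IsMNWOn (S : Set (Allocation n m)) (v : Fin n → ItemValues m) (A : Allocation n m) : Prop :=
  A ∈ S ∧ ∀ B ∈ S, nashWelfare v B ≤ nashWelfare v A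

variable {S : Set (Allocation n m)} {v : Fin n → ItemValues m} {A B : Allocation n m}

/-- The equal split already has positive welfare, so no factor of the optimal product vanishes. This
licenses the later divisions and logarithms. -/
lemma IsMNWOn.bundleValue_pos (hn : 0 < n) (hS : IsAdmissible S) (hA : IsMNWOn S v A)
    (i : Fin n) : 0 < bundleValue (v i) A i := by
  have h := prod_le_prod_of_nashWelfare_le hn (hA.2 _ hS.equal_mem)
  have hpos : 0 < ∏ i, bundleValue (v i) A i :=
    (Finset.prod_pos fun i _ => bundleValue_equal_pos hn (v i) i).trans_le h
  exact (bundleValue_nonneg _ _ i).lt_of_ne'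
    fun h0 => hpos.ne' (Finset.prod_eq_zero (Finset.mem_univ i) h0)

/-- The first-order optimality condition (proportional fairness) for maximum Nash welfare. -/
lemma IsMNWOn.sum_div_le (hn : 0 < n) (hS : IsAdmissible S) (hA : IsMNWOn S v A) (hB : B ∈ S) :
    ∑ i, bundleValue (v i) B i / bundleValue (v i) A i ≤ n := by
  set x : Fin n → ℝ := fun i => bundleValue (v i) A i with hx
  set y : Fin n → ℝ := fun i => bundleValue (v i) B i with hy
  have hxpos : ∀ i, 0 < x i := hA.bundleValue_pos hn hS
  have hy0 : ∀ i, 0 ≤ y i := fun i => bundleValue_nonneg _ _ i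
  -- Moving from `A` towards `B` cannot increase the sum of logarithms; `1 - 1/u ≤ log u` makes this
  -- rational in `s`, and `s → 0` then gives the claim.
  have key : ∀ s ∈ Set.Ioo (0 : ℝ) 1, ∑ i, (y i - x i) / (x i + s * (y i - x i)) ≤ 0 := by
    rintro s ⟨hs0, hs1⟩
    have hz : ∀ i, 0 < x i + s * (y i - x i) := fun i => by
      nlinarith [hxpos i, mul_nonneg hs0.le (hy0 i), mul_pos (sub_pos.2 hs1) (hxpos i)]
    have h := prod_le_prod_of_nashWelfare_le hn
      (hA.2 _ (hS.mix_mem A hA.1 B hB s hs0.le hs1.le))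
    simp only [bundleValue_mix] at h
    have hlog := Real.log_le_log (Finset.prod_pos fun i _ => hz i) h
    rw [Real.log_prod fun i _ => (hz i).ne', Real.log_prod fun i _ => (hxpos i).ne'] at hlog
    have hle : ∑ i, s * ((y i - x i) / (x i + s * (y i - x i))) ≤
        ∑ i, (Real.log (x i + s * (y i - x i)) - Real.log (x i)) := by
      refine Finset.sum_le_sum fun i _ => ?_
      rw [← Real.log_div (hz i).ne' (hxpos i).ne']
      refine le_trans (le_of_eq ?_) (Real.one_sub_inv_le_log_of_pos (div_pos (hz i) (hxpos i)))
      have := (hz i).ne'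
      rw [inv_div, eq_sub_iff_add_eq, ← mul_div_assoc, ← add_div, div_eq_one_iff_eq this]
      ring
    rw [← Finset.mul_sum, Finset.sum_sub_distrib] at hle
    have : s * ∑ i, (y i - x i) / (x i + s * (y i - x i)) ≤ 0 := hle.trans (sub_nonpos.2 hlog)
    exact nonpos_of_mul_nonpos_right this hs0
  have hcont : ContinuousAt (fun s : ℝ => ∑ i, (y i - x i) / (x i + s * (y i - x i))) 0 := by
    refine tendsto_finsetSum _ fun i _ => ?_
    refine ContinuousAt.div (by fun_prop) (by fun_prop) ?_
    simpa using (hxpos i).ne'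
  have hlim := le_of_tendsto (hcont.tendsto.mono_left (nhdsWithin_le_nhds (s := Set.Ioi 0)))
    (eventually_of_mem (Ioo_mem_nhdsGT one_pos) key)
  have hsum : ∑ i, (y i - x i) / (x i + 0 * (y i - x i)) = ∑ i, y i / x i - n := by
    simp [sub_div, Finset.sum_sub_distrib, div_self (hxpos _).ne']
  linarith

lemma two_le_div_add_div {a b : ℝ} (ha : 0 < a) (hb : 0 < b) : 2 ≤ a / b + b / a := by
  rw [div_add_div _ _ hb.ne' ha.ne', le_div_iff₀ (mul_pos hb ha)]
  nlinarith [sq_nonneg (a - b)]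

lemma eq_of_div_add_div_eq_two {a b : ℝ} (ha : 0 < a) (hb : 0 < b) (h : a / b + b / a = 2) :
    a = b := by
  rw [div_add_div _ _ hb.ne' ha.ne', div_eq_iff (mul_pos hb ha).ne'] at h
  have : (a - b) ^ 2 = 0 := by linarith
  exact sub_eq_zero.1 (pow_eq_zero_iff two_ne_zero |>.1 this)

/-- The values in an allocation that satisfies the market equilibrium inequality agree with those
of every allocation of maximum Nash welfare. -/
lemma IsMNWOn.bundleValue_eq (hn : 0 < n) (hS : IsAdmissible S) (hA : IsMNWOn S v A) (hB : B ∈ S)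
    (hpos : ∀ i, 0 < bundleValue (v i) B i)
    (h : ∑ i, bundleValue (v i) A i / bundleValue (v i) B i ≤ n) (i : Fin n) :
    bundleValue (v i) A i = bundleValue (v i) B i := by
  have h1 := hA.sum_div_le hn hS hB
  have hApos := hA.bundleValue_pos hn hS
  have hge : ∀ j ∈ Finset.univ, 0 ≤ bundleValue (v j) A j / bundleValue (v j) B j +
      bundleValue (v j) B j / bundleValue (v j) A j - 2 :=
    fun j _ => sub_nonneg.2 (two_le_div_add_div (hApos j) (hpos j))
  have hsum : ∑ j, (bundleValue (v j) A j / bundleValue (v j) B j +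
      bundleValue (v j) B j / bundleValue (v j) A j - 2) = 0 := by
    refine le_antisymm ?_ (Finset.sum_nonneg hge)
    rw [Finset.sum_sub_distrib, Finset.sum_add_distrib]
    simp only [Finset.sum_const, Finset.card_univ, Fintype.card_fin, nsmul_eq_mul]
    linarith
  have := (Finset.sum_eq_zero_iff_of_nonneg hge).1 hsum i (Finset.mem_univ i)
  exact eq_of_div_add_div_eq_two (hApos i) (hpos i) (by linarith)

/-- No misreport more than doubles the true value of an agent. -/
lemma IsMNWOn.bundleValue_misreport_le (hn : 0 < n) (hS : IsAdmissible S) (i : Fin n)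
    (w : ItemValues m) (hA : IsMNWOn S v A) (hB : IsMNWOn S (Function.update v i w) B) :
    bundleValue (v i) B i ≤ 2 * bundleValue (v i) A i := by
  have h1 := hA.sum_div_le hn hS hB.1
  have h2 := hB.sum_div_le hn hS hA.1
  have hApos := hA.bundleValue_pos hn hS
  have hBpos := hB.bundleValue_pos hn hS
  rw [← Finset.add_sum_erase _ _ (Finset.mem_univ i)] at h1 h2
  -- The ratio in terms of the manipulator's reported values is simply discarded.
  have h3 : 0 ≤ bundleValue (Function.update v i w i) A i /
      bundleValue (Function.update v i w i) B i :=
    div_nonneg (bundleValue_nonneg _ _ _) (bundleValue_nonneg _ _ _)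
  have h4 : ∑ j ∈ Finset.univ.erase i, (2 : ℝ) ≤
      ∑ j ∈ Finset.univ.erase i, (bundleValue (v j) B j / bundleValue (v j) A j +
        bundleValue (Function.update v i w j) A j /
          bundleValue (Function.update v i w j) B j) := by
    refine Finset.sum_le_sum fun j hj => ?_
    have hBj := hBpos j
    rw [Function.update_of_ne (Finset.ne_of_mem_erase hj)] at hBj ⊢
    exact two_le_div_add_div hBj (hApos j)
  rw [Finset.sum_add_distrib, Finset.sum_const, Finset.card_erase_of_mem (Finset.mem_univ i),
    Finset.card_univ, Fintype.card_fin, nsmul_eq_mul, Nat.cast_pred hn] at h4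
  rw [← div_le_iff₀ (hApos i)]
  linarith

/-! ### A family of instances with incentive ratio tending to two -/

/-- The values `(a, b)` of two items. -/
def pairValues (a b : ℝ) (ha : 0 ≤ a) (hb : 0 < b) : ItemValues 2 :=
  ⟨![a, b], fun t => by fin_cases t <;> simp [ha, hb.le], by simpa using by linarith⟩

lemma bundleValue_pairValues {a b : ℝ} (ha : 0 ≤ a) (hb : 0 < b) (A : Allocation n 2)
    (i : Fin n) :
    bundleValue (pairValues a b ha hb) A i = a * A.share i 0 + b * A.share i 1 := by
  simp [bundleValue, pairValues, Fin.sum_univ_two]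

/-- Agent `0` has the values `(a, b)`, the other agents care for the second item only. -/
def pairProfile (k : ℕ) (a b : ℝ) (ha : 0 ≤ a) (hb : 0 < b) : Fin (k + 1) → ItemValues 2 :=
  Fin.cons (pairValues a b ha hb) fun _ => pairValues 0 1 le_rfl one_pos

/-- Agent `0` gets the first item and the part `1 - k * q` of the second item, each other agent
gets the part `q` of the second item. -/
def pairAllocation (k : ℕ) (q : ℝ) (hq : 0 ≤ q) (hq1 : k * q ≤ 1) : Allocation (k + 1) 2 where
  share := Fin.cons ![1, 1 - k * q] fun _ => ![0, q]
  share_nonneg i t := by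
    refine Fin.cases ?_ (fun j => ?_) i <;> fin_cases t <;> simp [hq, hq1]
  sum_share_le_one t := by
    fin_cases t <;> simp [Fin.sum_univ_succ]

lemma pairAllocation_isComplete {k : ℕ} {q : ℝ} (hq : 0 ≤ q) (hq1 : k * q ≤ 1) :
    (pairAllocation k q hq hq1).IsComplete := by
  intro t
  fin_cases t <;> simp [pairAllocation, Fin.sum_univ_succ]

section Instances

variable {k : ℕ} {S : Set (Allocation (k + 1) 2)} {A : Allocation (k + 1) 2}

lemma bundleValue_pairProfile_zero {a b : ℝ} (ha : 0 ≤ a) (hb : 0 < b) :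
    bundleValue (pairProfile k a b ha hb 0) A 0 = a * A.share 0 0 + b * A.share 0 1 :=
  bundleValue_pairValues ha hb A 0

lemma bundleValue_pairProfile_succ {a b : ℝ} (ha : 0 ≤ a) (hb : 0 < b) (j : Fin k) :
    bundleValue (pairProfile k a b ha hb j.succ) A j.succ = A.share j.succ 1 := by
  have h := bundleValue_pairValues le_rfl one_pos A j.succ
  rw [zero_mul, one_mul, zero_add] at h
  exact h

lemma Allocation.share_zero_le_one (A : Allocation (k + 1) 2) : A.share 0 0 ≤ 1 :=
  (Finset.single_le_sum (fun i _ => A.share_nonneg i 0) (Finset.mem_univ 0)).trans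
    (A.sum_share_le_one 0)

lemma Allocation.share_add_sum_share_succ_le (A : Allocation (k + 1) 2) :
    A.share 0 1 + ∑ j : Fin k, A.share j.succ 1 ≤ 1 := by
  have h := A.sum_share_le_one 1
  rwa [Fin.sum_univ_succ] at h

/-- The values of a maximum Nash welfare allocation for a `pairProfile`, when `pairAllocation` is
a market equilibrium. -/
lemma IsMNWOn.bundleValue_pairProfile {a b q : ℝ} (ha : 0 ≤ a) (hb : 0 < b)
    (hS : IsAdmissible S) (hA : IsMNWOn S (pairProfile k a b ha hb) A) (hq : 0 < q)
    (hq1 : k * q ≤ 1) (hmem : pairAllocation k q hq.le hq1 ∈ S)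
    {u : ℝ} (hu : 0 < u) (hu_eq : u = a + b * (1 - k * q))
    (hbq : b * q ≤ u) (hsum : a / u + 1 / q ≤ k + 1) :
    a * A.share 0 0 + b * A.share 0 1 = u ∧ ∀ j : Fin k, A.share j.succ 1 = q := by
  have hB0 : bundleValue (pairProfile k a b ha hb 0) (pairAllocation k q hq.le hq1) 0 = u := by
    rw [bundleValue_pairProfile_zero, hu_eq]
    simp [pairAllocation]
  have hB : ∀ j : Fin k, bundleValue (pairProfile k a b ha hb j.succ)
      (pairAllocation k q hq.le hq1) j.succ = q := fun j => by
    rw [bundleValue_pairProfile_succ]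
    simp [pairAllocation]
  have h := hA.bundleValue_eq k.succ_pos hS hmem
    (fun i => Fin.cases (hB0 ▸ hu) (fun j => (hB j).symm ▸ hq) i) ?_
  · refine ⟨?_, fun j => ?_⟩
    · rw [← bundleValue_pairProfile_zero ha hb, h 0, hB0]
    · rw [← bundleValue_pairProfile_succ ha hb j, h j.succ, hB]
  · rw [Fin.sum_univ_succ, hB0, bundleValue_pairProfile_zero]
    simp only [hB, bundleValue_pairProfile_succ, ← Finset.sum_div]
    -- Equilibrium prices are `a / u` and `1 / q`: no agent's scaled value for an item exceeds its
    -- price, and by `hsum` the prices total at most `k + 1`.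
    have h1 : a * A.share 0 0 / u ≤ a / u := by
      gcongr
      exact mul_le_of_le_one_right ha A.share_zero_le_one
    have h2 : b * A.share 0 1 / u ≤ A.share 0 1 / q := by
      rw [div_le_div_iff₀ hu hq]
      nlinarith [A.share_nonneg 0 1]
    have h3 : A.share 0 1 / q + (∑ j : Fin k, A.share j.succ 1) / q ≤ 1 / q := by
      rw [← add_div]
      gcongr
      exact A.share_add_sum_share_succ_le
    rw [add_div]
    push_cast
    linarith

/-- An agent can gain the factor `2 k / (k + 1)` by a misreport. -/
lemma exists_misreport (hk : 0 < k) (hS : IsAdmissible S)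
    (hmem : ∀ (q : ℝ) (hq : 0 ≤ q) (hq1 : k * q ≤ 1), pairAllocation k q hq hq1 ∈ S) :
    ∃ (v : Fin (k + 1) → ItemValues 2) (w : ItemValues 2), ∀ A A' : Allocation (k + 1) 2,
      IsMNWOn S v A → IsMNWOn S (Function.update v 0 w) A' →
        bundleValue (v 0) A 0 = 1 ∧ bundleValue (v 0) A' 0 = 2 * k / (k + 1) := by
  have hk0 : (0 : ℝ) < k := by exact_mod_cast hk
  have hk1 : (1 : ℝ) ≤ k := by exact_mod_cast hk
  have he : (0 : ℝ) < 1 / k ^ 2 := by positivity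
  refine ⟨pairProfile k 1 k zero_le_one hk0, pairValues (1 / k ^ 2) 1 he.le one_pos,
    fun A A' hA hA' => ⟨?_, ?_⟩⟩
  · have hq1 : (k : ℝ) * (1 / k) ≤ 1 := by rw [mul_one_div_cancel hk0.ne']
    rw [bundleValue_pairProfile_zero]
    refine (hA.bundleValue_pairProfile zero_le_one hk0 hS (one_div_pos.2 hk0) hq1
      (hmem _ _ _) one_pos ?_ hq1 ?_).1
    · rw [mul_one_div_cancel hk0.ne']
      ring
    · rw [one_div_one_div]
      linarith
  · have hv : Function.update (pairProfile k 1 k zero_le_one hk0) 0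
        (pairValues (1 / k ^ 2) 1 he.le one_pos) = pairProfile k (1 / k ^ 2) 1 he.le one_pos :=
      Fin.update_cons_zero _ _ _
    rw [hv] at hA'
    set e : ℝ := 1 / k ^ 2 with he_def
    -- Under the misreport all `k + 1` agents share the reported total `1 + e` equally. The true
    -- value becomes `1 + k * (c - e)`, where `k ^ 2 * e = 1`.
    set c : ℝ := (1 + e) / (k + 1) with hc_def
    have hc : 0 < c := by positivity
    have hkc : c * (k + 1) = 1 + e := div_mul_cancel₀ _ (by positivity)
    have hke : k * e ≤ 1 := by
      rw [he_def, mul_one_div, div_le_one (by positivity)]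
      nlinarith
    have hq1 : k * c ≤ 1 := by
      rw [hc_def, mul_div_assoc', div_le_one (by positivity)]
      linarith
    obtain ⟨h0, hj⟩ := hA'.bundleValue_pairProfile he.le one_pos hS hc hq1 (hmem _ _ _) hc
      (by linarith) (by linarith)
      (by rw [← add_div, div_le_iff₀ hc]; linarith)
    have hX := A'.share_add_sum_share_succ_le
    simp only [hj, Finset.sum_const, Finset.card_univ, Fintype.card_fin, nsmul_eq_mul] at hX
    -- The others take `k * c` of the second item, leaving at most `c - e`; reaching value `c`
    -- requires the whole first item.
    have h00 : A'.share 0 0 = 1 :=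
      le_antisymm A'.share_zero_le_one (le_of_mul_le_mul_left (by linarith) he)
    have h01 : A'.share 0 1 = c - e := by
      rw [h00] at h0
      linarith
    rw [bundleValue_pairProfile_zero, h00, h01, hc_def, he_def]
    field_simp
    ring

end Instances

/-! ### The incentive ratio of maximum Nash welfare mechanisms -/

variable {M : Mechanism} {T : (n m : ℕ) → Set (Allocation n m)}

/-- A mechanism that maximizes Nash welfare over convex sets has incentive ratio at most two. -/
lemma incentiveRatio_le_two (hT : ∀ n m, 0 < n → IsAdmissible (T n m))
    (hM : ∀ n m, 0 < n → ∀ v, IsMNWOn (T n m) v (M n m v)) : M.incentiveRatio ≤ 2 := by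
  refine iSup_le fun n => iSup_le fun m => iSup_le fun v => iSup_le fun i => iSup_le fun w => ?_
  have hn : 0 < n := i.pos
  refine ENNReal.div_le_of_le_mul ?_
  rw [show (2 : ℝ≥0∞) = ENNReal.ofReal 2 by simp, ← ENNReal.ofReal_mul zero_le_two]
  exact ENNReal.ofReal_le_ofReal
    ((hM n m hn v).bundleValue_misreport_le hn (hT n m hn) i w (hM n m hn _))

/-- A mechanism that maximizes Nash welfare over convex sets which contain the complete
allocations has incentive ratio at least two. -/
lemma two_le_incentiveRatio (hT : ∀ n m, 0 < n → IsAdmissible (T n m))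
    (hT' : ∀ n m, ∀ A : Allocation n m, A.IsComplete → A ∈ T n m)
    (hM : ∀ n m, 0 < n → ∀ v, IsMNWOn (T n m) v (M n m v)) : 2 ≤ M.incentiveRatio := by
  have key : ∀ k : ℕ, 0 < k → ENNReal.ofReal (2 * k / (k + 1)) ≤ M.incentiveRatio := by
    intro k hk
    obtain ⟨v, w, h⟩ := exists_misreport hk (hT (k + 1) 2 k.succ_pos)
      fun q hq hq1 => hT' _ _ _ (pairAllocation_isComplete hq hq1)
    obtain ⟨h1, h2⟩ := h _ _ (hM _ _ k.succ_pos v) (hM _ _ k.succ_pos (Function.update v 0 w))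
    refine le_trans ?_ (le_iSup_of_le (k + 1) <| le_iSup_of_le 2 <| le_iSup_of_le v <|
      le_iSup_of_le 0 <| le_iSup_of_le w le_rfl)
    rw [h1, h2]
    simp
  have hlim : Tendsto (fun k : ℕ => ENNReal.ofReal (2 * k / (k + 1))) atTop
      (𝓝 (ENNReal.ofReal 2)) := by
    refine ENNReal.tendsto_ofReal ?_
    have := (tendsto_natCast_div_add_atTop (1 : ℝ)).const_mul 2
    simpa [mul_div_assoc] using this
  have h2 : ENNReal.ofReal 2 ≤ M.incentiveRatio :=
    le_of_tendsto hlim ((eventually_gt_atTop 0).mono key)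
  simpa using h2

end DivisibleItems

end

theorem mainTheorem6 :
    (∀ M : DivisibleItems.Mechanism, M.IsMNWWithoutFreeDisposal → M.incentiveRatio = 2) ∧
    (∀ M : DivisibleItems.Mechanism, M.IsMNWWithFreeDisposal → 2 ≤ M.incentiveRatio) := by
  refine ⟨fun M hM => le_antisymm ?_ ?_, fun M hM => ?_⟩
  · exact DivisibleItems.incentiveRatio_le_two
      (fun _ _ hn => DivisibleItems.isAdmissible_complete hn) hM
  · exact DivisibleItems.two_le_incentiveRatio
      (fun _ _ hn => DivisibleItems.isAdmissible_complete hn) (fun _ _ _ hA => hA) hM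
  · exact DivisibleItems.two_le_incentiveRatio (T := fun _ _ => Set.univ)
      (fun _ _ _ => DivisibleItems.isAdmissible_univ) (fun _ _ _ _ => trivial)
      fun n m hn v => ⟨trivial, fun B _ => hM n m hn v B⟩
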